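/- For $\delta\in\mathbb R$ let $$\lambda(\delta)=\sup\,\mathbb P\bigl(|X-Y|\ge 1-\delta\bigr),\qquad X=\mathbb P(A\mid\mathcal G),\quad Y=\mathbb P(A\mid\mathcal H),$$ where the supremum is taken over all probability spaces $(\Omega,\mathcal F,\mathbb P)$, all events $A\in\mathcal F$ and all sub-$\sigma$-fields $\mathcal G,\mathcal H$ of $\mathcal F$. Then for every $\delta\in(0,1/2)$, $$\lambda(\delta)=\frac{2\delta}{1+\delta}.$$ -/

import Mathlib

/-!
For the upper bound, regard `X` and `Y` as prices of a unit payment on `A`, and at each price buy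
one unit if it is at most `δ` and sell one unit if it is at least `1 - δ`. Since `X` and `Y` are
conditional probabilities, both trades are fair, so the total gain has mean zero. Each trade loses
at most `δ`, and where `|X - Y| ≥ 1 - δ` the trades have opposite directions, so that together they
gain exactly `|X - Y|`, whatever the outcome. Hence `2 * δ` plus the total gain is nonnegative,
is at least `1 + δ` where `|X - Y| ≥ 1 - δ`, and has mean `2 * δ`; Markov's inequality gives the
bound `2 * δ / (1 + δ)`.

The bound is attained by `A = B ∪ C`, with `B` and `C` disjoint of probability `a = δ / (1 + δ)`,
when `G` is generated by `B` and `H` by `C`: on `B` we have `X = 1` and `Y = a / (1 - a) = δ`, and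
on `C` the other way round.
-/

open MeasureTheory ProbabilityTheory

universe u

/-- The numbers `P(|X - Y| ≥ 1 - δ)`, where `X = P(A | G)` and `Y = P(A | H)`, for all probability
spaces `(Ω, mΩ, P)`, all events `A` and all sub-σ-fields `G`, `H` of `mΩ`. Here `P⟦A|G⟧` is the
conditional expectation of the (real-valued) indicator function of `A` given `G`; any other version
of the conditional probability gives the same numbers. -/
def contradictionProbs (δ : ℝ) : Set ℝ :=
  {p | ∃ (Ω : Type u) (G H mΩ : MeasurableSpace Ω) (P : Measure[mΩ] Ω) (A : Set Ω),
    IsProbabilityMeasure P ∧ MeasurableSet[mΩ] A ∧ G ≤ mΩ ∧ H ≤ mΩ ∧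
      p = P.real {ω | 1 - δ ≤ |(P⟦A|G⟧) ω - (P⟦A|H⟧) ω|}}

/-- `λ(δ)`: the supremum of `P(|P(A|G) - P(A|H)| ≥ 1 - δ)`. It is a genuine supremum by
`contradictionProbs_nonempty` and `contradictionProbs_bddAbove`. -/
noncomputable def contradictionSup (δ : ℝ) : ℝ :=
  sSup (contradictionProbs.{u} δ)

theorem contradictionProbs_nonempty (δ : ℝ) : (contradictionProbs.{u} δ).Nonempty :=
  ⟨_, PUnit, ⊤, ⊤, ⊤, @Measure.dirac PUnit ⊤ PUnit.unit, ∅,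
    @Measure.dirac.isProbabilityMeasure PUnit ⊤ PUnit.unit,
    @MeasurableSet.empty _ ⊤, le_rfl, le_rfl, rfl⟩

theorem contradictionProbs_bddAbove (δ : ℝ) : BddAbove (contradictionProbs.{u} δ) := by
  refine ⟨1, ?_⟩
  rintro p ⟨Ω, G, H, mΩ, P, A, hP, -, -, -, rfl⟩
  exact measureReal_le_one

/-- The stake on an event of somebody who, offered to trade at the price `x`, buys one unit if
`x ≤ δ` and sells one unit if `1 - δ ≤ x`. If the outcome is `t`, the gain is `stake δ x * (t - x)`.
For `1 / 2 ≤ δ` the two cases overlap, and buying takes precedence. -/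
noncomputable def stake (δ x : ℝ) : ℝ :=
  if x ≤ δ then 1 else if 1 - δ ≤ x then -1 else 0

theorem measurable_stake (δ : ℝ) : Measurable (stake δ) :=
  .ite measurableSet_Iic measurable_const (.ite measurableSet_Ici measurable_const measurable_const)

theorem abs_stake_le_one (δ x : ℝ) : |stake δ x| ≤ 1 := by
  unfold stake
  split_ifs <;> simp

theorem neg_le_stake_mul_sub {δ x t : ℝ} (hδ : 0 ≤ δ) (ht : t ∈ Set.Icc (0 : ℝ) 1) :
    -δ ≤ stake δ x * (t - x) := by
  obtain ⟨ht0, ht1⟩ := ht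
  unfold stake
  split_ifs <;> linarith

theorem stake_mul_sub_add_stake_mul_sub {δ x y : ℝ} (hδ : δ < 1 / 2) (hx : x ∈ Set.Icc (0 : ℝ) 1)
    (hy : y ∈ Set.Icc (0 : ℝ) 1) (hxy : 1 - δ ≤ |x - y|) (t : ℝ) :
    stake δ x * (t - x) + stake δ y * (t - y) = |x - y| := by
  wlog hle : y ≤ x generalizing x y
  · rw [add_comm, abs_sub_comm]
    exact this hy hx (abs_sub_comm x y ▸ hxy) (le_of_not_ge hle)
  rw [abs_of_nonneg (sub_nonneg.2 hle)] at hxy ⊢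
  have stake_x : stake δ x = -1 := by
    rw [stake, if_neg (by linarith [hy.1]), if_pos (by linarith [hy.1])]
  have stake_y : stake δ y = 1 := if_pos (by linarith [hx.2])
  rw [stake_x, stake_y]
  ring

theorem integral_mul_sub_condExp_eq_zero {Ω : Type*} {m mΩ : MeasurableSpace Ω} {μ : Measure Ω}
    {f g : Ω → ℝ} (hm : m ≤ mΩ) [SigmaFinite (μ.trim hm)] (hg : StronglyMeasurable[m] g)
    {c : ℝ} (hgc : ∀ ω, ‖g ω‖ ≤ c) (hf : Integrable f μ) :
    ∫ ω, g ω * (f ω - (μ[f|m]) ω) ∂μ = 0 := by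
  have hg' : AEStronglyMeasurable g μ := (hg.mono hm).aestronglyMeasurable
  have hgf : Integrable (g * f) μ := hf.bdd_mul hg' (ae_of_all _ hgc)
  have hgX : Integrable (g * μ[f|m]) μ := integrable_condExp.bdd_mul hg' (ae_of_all _ hgc)
  calc ∫ ω, g ω * (f ω - (μ[f|m]) ω) ∂μ
      = ∫ ω, (g * f) ω ∂μ - ∫ ω, (g * μ[f|m]) ω ∂μ := by
        rw [← integral_sub hgf hgX]
        simp only [Pi.mul_apply, mul_sub]
    _ = ∫ ω, (g * f) ω ∂μ - ∫ ω, (μ[g * f|m]) ω ∂μ := by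
        rw [integral_congr_ae (condExp_mul_of_stronglyMeasurable_left hg hgf hf)]
    _ = 0 := by rw [integral_condExp hm, sub_self]

section UpperBound

/-- The net gain from trading `f` at its conditional expectation given `m`, with the stakes
`stake δ`. -/
noncomputable def tradingGain {Ω : Type*} {_ : MeasurableSpace Ω} (P : Measure Ω) (f : Ω → ℝ)
    (δ : ℝ) (m : MeasurableSpace Ω) (ω : Ω) : ℝ :=
  stake δ ((P[f|m]) ω) * (f ω - (P[f|m]) ω)

variable {Ω : Type*} {m G H mΩ : MeasurableSpace Ω} {P : Measure Ω} {f : Ω → ℝ} {δ : ℝ}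

theorem stronglyMeasurable_stake_condExp :
    StronglyMeasurable[m] fun ω => stake δ ((P[f|m]) ω) :=
  ((measurable_stake δ).comp stronglyMeasurable_condExp.measurable).stronglyMeasurable

theorem integrable_tradingGain (hm : m ≤ mΩ) (hf : Integrable f P) :
    Integrable (tradingGain P f δ m) P :=
  (hf.sub integrable_condExp).bdd_mul
    (stronglyMeasurable_stake_condExp.mono hm).aestronglyMeasurable
    (ae_of_all _ fun _ => abs_stake_le_one ..)

theorem integral_tradingGain (hm : m ≤ mΩ) [SigmaFinite (P.trim hm)] (hf : Integrable f P) :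
    ∫ ω, tradingGain P f δ m ω ∂P = 0 :=
  integral_mul_sub_condExp_eq_zero hm stronglyMeasurable_stake_condExp
    (fun _ => abs_stake_le_one ..) hf

theorem measureReal_le_abs_condExp_sub_condExp_le [IsProbabilityMeasure P] (hδ : 0 ≤ δ)
    (hδ' : δ < 1 / 2) (hG : G ≤ mΩ) (hH : H ≤ mΩ) (hf : Integrable f P)
    (hf01 : ∀ᵐ ω ∂P, f ω ∈ Set.Icc (0 : ℝ) 1) :
    P.real {ω | 1 - δ ≤ |(P[f|G]) ω - (P[f|H]) ω|} ≤ 2 * δ / (1 + δ) := by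
  let Z : Ω → ℝ := (fun _ => 2 * δ) + (tradingGain P f δ G + tradingGain P f δ H)
  have gain_int :=
    (integrable_tradingGain (δ := δ) hG hf).add (integrable_tradingGain (δ := δ) hH hf)
  have Z_int : Integrable Z P := (integrable_const _).add gain_int
  have integral_Z : ∫ ω, Z ω ∂P = 2 * δ := by
    rw [integral_add' (integrable_const _) gain_int,
      integral_add' (integrable_tradingGain hG hf) (integrable_tradingGain hH hf),
      integral_tradingGain hG hf, integral_tradingGain hH hf]
    simp
  have Z_nonneg : 0 ≤ᵐ[P] Z := by
    filter_upwards [hf01] with ω ht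
    have gain_ge (m) : -δ ≤ tradingGain P f δ m ω := neg_le_stake_mul_sub hδ ht
    simp only [Z, Pi.zero_apply, Pi.add_apply]
    linarith [gain_ge G, gain_ge H]
  have condExp_mem {m} (hm : m ≤ mΩ) : ∀ᵐ ω ∂P, (P[f|m]) ω ∈ Set.Icc (0 : ℝ) 1 :=
    (convex_Icc 0 1).condExp_mem hm hf isClosed_Icc hf01
  have Z_ge : ∀ᵐ ω ∂P, 1 - δ ≤ |(P[f|G]) ω - (P[f|H]) ω| → 1 + δ ≤ Z ω := by
    filter_upwards [condExp_mem hG, condExp_mem hH] with ω hX hY hXY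
    simp only [Z, Pi.add_apply, tradingGain, stake_mul_sub_add_stake_mul_sub hδ' hX hY hXY]
    linarith
  rw [le_div_iff₀' (by linarith), ← integral_Z]
  calc (1 + δ) * P.real {ω | 1 - δ ≤ |(P[f|G]) ω - (P[f|H]) ω|}
      ≤ (1 + δ) * P.real {ω | 1 + δ ≤ Z ω} := by
        gcongr ?_ * ?_
        exact ENNReal.toReal_mono (by finiteness) (measure_mono_ae Z_ge)
    _ ≤ ∫ ω, Z ω ∂P := mul_meas_ge_le_integral_of_nonneg Z_nonneg Z_int (1 + δ)

end UpperBound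

theorem generateFrom_singleton_compl {Ω : Type*} (s : Set Ω) :
    MeasurableSpace.generateFrom {sᶜ} = MeasurableSpace.generateFrom {s} := by
  have mem (t : Set Ω) : MeasurableSet[MeasurableSpace.generateFrom {t}] t :=
    MeasurableSpace.measurableSet_generateFrom rfl
  exact le_antisymm (MeasurableSpace.generateFrom_singleton_le (mem s).compl)
    (MeasurableSpace.generateFrom_singleton_le (mem sᶜ).of_compl)

section LowerBound

variable {Ω : Type*} {mΩ : MeasurableSpace Ω} {P : Measure Ω} {A B C : Set Ω}

theorem measureReal_cond (hB : MeasurableSet B) (A : Set Ω) :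
    P[|B].real A = (P.real B)⁻¹ * P.real (B ∩ A) := by
  simp only [measureReal_def, cond_apply hB, ENNReal.toReal_mul, ENNReal.toReal_inv]

theorem condProb_generateFrom_singleton_of_subset [IsFiniteMeasure P] (hA : MeasurableSet A)
    (hB : MeasurableSet B) (hBA : B ⊆ A) :
    P⟦A|MeasurableSpace.generateFrom {B}⟧ =ᵐ[P.restrict B] fun _ => 1 := by
  by_cases hB0 : P B = 0
  · rw [Measure.restrict_eq_zero.2 hB0]
    rfl
  have cond_eq : P[|B].real A = 1 := by
    rw [measureReal_cond hB, Set.inter_eq_left.2 hBA,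
      inv_mul_cancel₀ ((measureReal_ne_zero_iff (by finiteness)).2 hB0)]
  filter_upwards [condExp_set_generateFrom_singleton (μ := P) hB hA] with ω hω
  exact hω.trans cond_eq

variable [IsProbabilityMeasure P]

theorem condProb_union_generateFrom_singleton_of_disjoint (hB : MeasurableSet B)
    (hC : MeasurableSet C) (hBC : Disjoint B C) :
    P⟦B ∪ C|MeasurableSpace.generateFrom {C}⟧ =ᵐ[P.restrict B]
      fun _ => P.real B / (1 - P.real C) := by
  have hsub : B ⊆ Cᶜ := hBC.subset_compl_right
  have cond_eq : P[|Cᶜ].real (B ∪ C) = P.real B / (1 - P.real C) := by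
    rw [measureReal_cond hC.compl, probReal_compl_eq_one_sub hC, Set.inter_union_distrib_left,
      Set.compl_inter_self, Set.union_empty, Set.inter_eq_right.2 hsub, div_eq_inv_mul]
  rw [← generateFrom_singleton_compl C, ← cond_eq]
  exact ae_restrict_of_ae_restrict_of_subset hsub
    (condExp_set_generateFrom_singleton hC.compl (hB.union hC))

theorem ae_restrict_le_abs_condProb_union_sub (hB : MeasurableSet B) (hC : MeasurableSet C)
    (hBC : Disjoint B C) :
    ∀ᵐ ω ∂P.restrict B, 1 - P.real B / (1 - P.real C) ≤
      |(P⟦B ∪ C|MeasurableSpace.generateFrom {B}⟧) ω -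
        (P⟦B ∪ C|MeasurableSpace.generateFrom {C}⟧) ω| := by
  filter_upwards [
    condProb_generateFrom_singleton_of_subset (P := P) (hB.union hC) hB Set.subset_union_left,
    condProb_union_generateFrom_singleton_of_disjoint (P := P) hB hC hBC] with ω hX hY
  rw [hX, hY]
  exact le_abs_self _

theorem measureReal_union_le_measureReal_condProb_union_sub {a : ℝ} (hB : MeasurableSet B)
    (hC : MeasurableSet C) (hBC : Disjoint B C) (hBa : P.real B = a) (hCa : P.real C = a) :
    P.real (B ∪ C) ≤ P.real {ω | 1 - a / (1 - a) ≤
      |(P⟦B ∪ C|MeasurableSpace.generateFrom {B}⟧) ω -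
        (P⟦B ∪ C|MeasurableSpace.generateFrom {C}⟧) ω|} := by
  have on_B := ae_restrict_le_abs_condProb_union_sub (P := P) hB hC hBC
  have on_C := ae_restrict_le_abs_condProb_union_sub (P := P) hC hB hBC.symm
  simp only [Set.union_comm C B, abs_sub_comm, hBa, hCa] at on_B on_C
  refine ENNReal.toReal_mono (by finiteness) (measure_mono_ae ?_)
  filter_upwards [(ae_restrict_iff' hB).1 on_B, (ae_restrict_iff' hC).1 on_C] with ω hωB hωC hω
  exact hω.elim hωB hωC

end LowerBound

theorem exists_disjoint_measureReal_eq {a : ℝ} (ha : 0 ≤ a) (ha' : a ≤ 1 / 2) :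
    ∃ (Ω : Type u) (_ : MeasurableSpace Ω) (P : Measure Ω) (B C : Set Ω),
      IsProbabilityMeasure P ∧ MeasurableSet B ∧ MeasurableSet C ∧ Disjoint B C ∧
        P.real B = a ∧ P.real C = a := by
  let p : unitInterval := ⟨a, ha, by linarith⟩
  let q : unitInterval := ⟨1 - a, by linarith, by linarith⟩
  refine ⟨ULift unitInterval, inferInstance, volume.map ULift.up, ULift.down ⁻¹' Set.Iio p,
    ULift.down ⁻¹' Set.Ioi q, inferInstance, measurable_down measurableSet_Iio,
    measurable_down measurableSet_Ioi, ?_, ?_, ?_⟩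
  · have hpq : p ≤ q := Subtype.mk_le_mk.2 (by linarith)
    exact (Set.Iio_disjoint_Ioi_of_le hpq).preimage _
  · rw [map_measureReal_apply measurable_up (measurable_down measurableSet_Iio)]
    simp [← Set.preimage_comp, Function.comp_def, measureReal_def, p, ha]
  · rw [map_measureReal_apply measurable_up (measurable_down measurableSet_Ioi)]
    simp [← Set.preimage_comp, Function.comp_def, measureReal_def, q, ha]

theorem contradictionSup_le {δ : ℝ} (hδ : 0 ≤ δ) (hδ' : δ < 1 / 2) :
    contradictionSup.{u} δ ≤ 2 * δ / (1 + δ) := by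
  refine csSup_le (contradictionProbs_nonempty δ) ?_
  rintro _ ⟨Ω, G, H, mΩ, P, A, hP, hA, hG, hH, rfl⟩
  refine measureReal_le_abs_condExp_sub_condExp_le hδ hδ' hG hH
    ((integrable_const 1).indicator hA) (ae_of_all _ fun ω => ?_)
  exact ⟨Set.indicator_nonneg (fun _ _ => zero_le_one) ω,
    Set.indicator_le_self' (fun _ _ => zero_le_one) ω⟩

theorem le_contradictionSup {δ : ℝ} (hδ : 0 ≤ δ) (hδ' : δ ≤ 1) :
    2 * δ / (1 + δ) ≤ contradictionSup.{u} δ := by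
  set a : ℝ := δ / (1 + δ) with a_def
  have ha : 0 ≤ a := by positivity
  have ha' : a ≤ 1 / 2 := by
    rw [a_def, div_le_iff₀ (by positivity)]
    linarith
  have odds_a : a / (1 - a) = δ := by
    rw [a_def]
    field_simp
    ring
  obtain ⟨Ω, mΩ, P, B, C, hP, hB, hC, hBC, hBa, hCa⟩ :=
    exists_disjoint_measureReal_eq.{u} ha ha'
  calc 2 * δ / (1 + δ) = P.real (B ∪ C) := by
        rw [measureReal_union hBC hC, hBa, hCa]
        ring
    _ ≤ P.real {ω | 1 - δ ≤
          |(P⟦B ∪ C|MeasurableSpace.generateFrom {B}⟧) ω -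
            (P⟦B ∪ C|MeasurableSpace.generateFrom {C}⟧) ω|} := by
        simpa only [odds_a] using
          measureReal_union_le_measureReal_condProb_union_sub hB hC hBC hBa hCa
    _ ≤ contradictionSup δ :=
        le_csSup (contradictionProbs_bddAbove δ)
          ⟨Ω, _, _, mΩ, P, B ∪ C, hP, hB.union hC, MeasurableSpace.generateFrom_singleton_le hB,
            MeasurableSpace.generateFrom_singleton_le hC, rfl⟩

theorem theorem1p1 (δ : ℝ) (hδ : δ ∈ Set.Ioo (0 : ℝ) (1 / 2)) :
    contradictionSup.{u} δ = 2 * δ / (1 + δ) :=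
  le_antisymm (contradictionSup_le hδ.1.le hδ.2) (le_contradictionSup hδ.1.le (by linarith [hδ.2]))
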